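/- **Setting.** Parties $P$ (finite), iterations $1,\dots,T$. Public data of an execution: nonnegative column-stochastic matrices $W_1,\dots,W_T\in\mathbb R^{P\times P}$; sets $\mathrm{on}_t\subseteq P$ of online parties ($0\le t\le T$) with $\mathrm{on}_0=P$; $c\in\mathbb R^{T+1}$, $Z\in\mathbb R^{(T+1)\times T}$ forming a *valid* $(c,Z)$-Gaussian, i.e. $\sum_{t}(c_tu+\sum_kZ_{t,k}\eta_k)=u$ for all $u,\eta$, and both $(c,Z)$ and $Z$ without its last row are invertible. The weights of the real exchanges are, for $i\in\mathrm{on}_t$, $\hat W_{t;i,j}=W_{t;i,j}$ if $j\in\mathrm{on}_t\setminus\{i\}$, $\hat W_{t;i,j}=0$ if $j\notin\mathrm{on}_t$, $\hat W_{t;i,i}=W_{t;i,i}+\sum_{k\notin\mathrm{on}_t}W_{t;k,i}$; for $i\notin\mathrm{on}_t$, $\hat W_{t;i,j}=\mathbf 1[i=j]$. With $t'=|\{k<t:i\in\mathrm{on}_k\}|$, put $\hat c_{i,t}=c_{t'}$ if $i\in\mathrm{on}_t$ and $0$ otherwise; $\hat Z_{i,t,:}=Z_{t',:}$ if $i\in\mathrm{on}_t$,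 $t<T$; $\hat Z_{i,T,:}=-\sum_{s<t'}Z_{s,:}$ (with $t'$ taken at $t=T$) if $i\in\mathrm{on}_T$; $\hat Z_{i,t,:}=0$ if $i\notin\mathrm{on}_t$. On private values $x_i\in[0,1]$ the messages are $$y^{(0)}_i=v_{i,0},\qquad y_i^{(t)}=\sum_j\hat W_{t;i,j}y_j^{(t-1)}+v_{i,t},\qquad v_{i,t}=\hat c_{i,t}(x_i+\eta^{\mathrm{ind}}_i)+\sum_k\hat Z_{i,t,k}\eta_{i,k},$$ with all noise terms independent, $\eta^{\mathrm{ind}}_i\sim\mathcal N(0,\sigma_{\mathrm{ind}}^2)$, $\eta_{i,k}\sim\mathcal N(0,\sigma_\Delta^2)$. Let $w_i=\sum_t\hat c_{i,t}$. **Adversary.** A set $C\subset P$ is corrupted; $H=P\setminus C$, $n_H=|H|$. The adversary knows all public data, all values and noise terms of $C$, and the values $y^{(t)}_i$ for $(i,t)\in V\subseteq P\times[0,T]$, where $$V\supseteq V_C:=\{(i,T):i\in P\}\cup\{(i,t):t<T,\ i\in C\text{ or }\hat W_{t+1;j,i}\ne0\text{ for some }j\in C\}.$$ (For $C=\emptyset$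 and any such $V$ this is the eavesdropping adversary of E-DP; for $V=V_C$ it is the colluding adversary of C-DP.) Two datasets in $[0,1]^H$ are neighboring if they differ in at most one coordinate. The execution is $(\epsilon,\delta)$-E-DP/C-DP if for all values and noise terms of $C$, all neighboring $x,x'$ and all measurable sets $Y$, $\Pr(\mathrm{view}(x)\in Y)\le e^\epsilon\Pr(\mathrm{view}(x')\in Y)+\delta$, where $\mathrm{view}$ is the tuple of observed values $(y_i^{(t)})_{(i,t)\in V}$. Write the view as a function $\mathcal V(x+\eta^{\mathrm{ind}},\eta)$ of the honest inputs and noise terms. The message held by $i$ at time $t$ has been *seen* if $(i,s)\in V$ for some $s$ such that $i$ was offline at all times $r$ with $\min(s,t)<r\le\max(s,t)$ (so that $y_i^{(s)}=y_i^{(t)}$ is the same message); without dropouts this just says $(i,t)\in V$. Let $G^H$ be the directed graph on $H$ with an edge $i\to j$ whenever, for some $t\in[1,T]$, $\hat W_{t;j,i}>0$ and the message held by $i$ at time $t-1$ (which is what $i$ sends in iteration $t$) has not been seen. **Theorem.** Suppose that $n_H\ge2$, $0\le w_i\le1$ for all $i\in H$, and $w_{\mathrm{on}}:=\sum_{i\in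 H}w_i\neq1$. If $G^H$ is strongly connected, then there are, for all neighboring $x^A,x^B\in[0,1]^H$, vectors $\theta^{\mathrm{ind}}\in\mathbb R^{H}$ and $\theta^\Delta\in\mathbb R^{H\times T}$ (depending on $x^A,x^B$ and on the execution and the adversary, but not on $\epsilon,\delta$ or the variances), with $\|\theta^\Delta\|_2$ bounded over all neighboring pairs, such that $$\mathcal V(x^A+\eta^{\mathrm{ind}},\eta)=\mathcal V(x^B+\eta^{\mathrm{ind}}+\theta^{\mathrm{ind}},\eta+\theta^\Delta)\quad\text{for all }\eta^{\mathrm{ind}},\eta,$$ and such that for all $\epsilon,\delta\in(0,1)$ and all $\kappa$ with $\kappa^2>2\ln(1.25/\delta)$ the execution is $(\epsilon,\delta)$-E-DP (respectively C-DP) whenever $\sigma_\Delta^2>0$, $$\sigma_{\mathrm{ind}}^2>\frac{(n_H-1)\kappa^2}{(w_{\mathrm{on}}-1)^2\epsilon^2}\quad\text{and}\quad\sigma_\Delta^2\ge\frac{\|\theta^\Delta\|_2^2}{\frac{\epsilon^2}{\kappa^2}-\frac{n_H-1}{(w_{\mathrm{on}}-1)^2\sigma_{\mathrm{ind}}^2}}\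 \text{ for all neighboring }x^A,x^B.$$ -/

import Mathlib

open MeasureTheory ProbabilityTheory
open scoped NNReal ENNReal

noncomputable section

/-- `(ε, δ)`-differential privacy of a randomized algorithm `A`, whose internal randomness is `ω`
distributed according to `μ`, with respect to a neighboring relation on datasets. -/
def IsDP {D Ω Y : Type*} [MeasurableSpace Ω] [MeasurableSpace Y]
    (neighboring : D → D → Prop) (μ : Measure Ω) (A : D → Ω → Y) (ε δ : ℝ) : Prop :=
  ∀ x x' : D, neighboring x x' → ∀ S : Set Y, MeasurableSet S →
    μ {ω | A x ω ∈ S} ≤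
      ENNReal.ofReal (Real.exp ε) * μ {ω | A x' ω ∈ S} + ENNReal.ofReal δ

/-- Two datasets with values in `[0, 1]` are neighboring if they differ in the value of at most one
party. -/
def Neighboring {H : Type*} (xA xB : H → ℝ) : Prop :=
  (∀ i, xA i ∈ Set.Icc (0 : ℝ) 1) ∧ (∀ i, xB i ∈ Set.Icc (0 : ℝ) 1) ∧
    ∃ i, ∀ j, j ≠ i → xA j = xB j

/-- A vector indexed by all parties, assembled from its honest and its corrupted entries. -/
def glue {P α : Type*} [DecidableEq P] (C : Finset P)
    (h : {i // i ∉ C} → α) (a : {i // i ∈ C} → α) : P → α :=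
  fun i => if hi : i ∈ C then a ⟨i, hi⟩ else h ⟨i, hi⟩

/-- The public data of a run of the incremental averaging protocol with `T` mixing iterations
among the parties `P`. Times are `0, …, T`; the iteration that leads from time `t` to time `t + 1`
is indexed by `t : Fin T`, so it goes from `t.castSucc` to `t.succ`. -/
structure Execution (P : Type*) [Fintype P] (T : ℕ) where
  /-- `weight t i j` is the weight that `i` is meant to give to the message of `j`. -/
  weight : Fin T → Matrix P P ℝ
  weight_nonneg : ∀ t i j, 0 ≤ weight t i j
  weight_col_sum : ∀ t j, ∑ i, weight t i j = 1
  /-- the parties that have not dropped out at a given time -/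
  online : Fin (T + 1) → Finset P
  online_zero : online 0 = Finset.univ
  /-- the vector `c` of the `(c, Z)`-Gaussian injection distribution -/
  coeff : Fin (T + 1) → ℝ
  /-- the matrix `Z` of the `(c, Z)`-Gaussian injection distribution -/
  noiseMat : Matrix (Fin (T + 1)) (Fin T) ℝ

namespace Execution

variable {P : Type*} [Fintype P] [DecidableEq P] {T : ℕ} (E : Execution P T)

/-- Validity of the `(c, Z)`-Gaussian: the injected terms add up to the injected value whatever the
noise is, the square matrix `(c, Z)` is invertible, and so is `Z` without its last row. -/
def Valid {P : Type*} [Fintype P] {T : ℕ} (E : Execution P T) : Prop :=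
  (∀ (u : ℝ) (η : Fin T → ℝ),
      ∑ t, (E.coeff t * u + ∑ k, E.noiseMat t k * η k) = u) ∧
    IsUnit (Matrix.of fun t => Matrix.vecCons (E.coeff t) (E.noiseMat t) :
      Matrix (Fin (T + 1)) (Fin (T + 1)) ℝ) ∧
    IsUnit (E.noiseMat.submatrix Fin.castSucc id)

/-- The weights of the exchanges that really take place in an iteration. An online party uses the
weights of the online parties and keeps, on top of its own weight, the weight that it could not
send to the offline parties; an offline party keeps its message unchanged. -/
def onlineWeight (t : Fin T) : Matrix P P ℝ :=
  Matrix.of fun i j =>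
    if i ∈ E.online t.succ then
      if j = i then
        E.weight t i i + ∑ k ∈ Finset.univ.filter (fun k => k ∉ E.online t.succ), E.weight t k i
      else if j ∈ E.online t.succ then E.weight t i j else 0
    else if j = i then 1 else 0

/-- The number of times before `t` at which party `i` was online. -/
def onlineCount (i : P) (t : Fin (T + 1)) : ℕ :=
  (Finset.univ.filter fun k => k < t ∧ i ∈ E.online k).card

lemma onlineCount_le (i : P) (t : Fin (T + 1)) : E.onlineCount i t ≤ t := by
  unfold onlineCount
  calc _ ≤ (Finset.Iio t).card := by
        apply Finset.card_le_card
        intro k hk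
        simp only [Finset.mem_filter] at hk
        simpa using hk.2.1
    _ = t := by simp

/-- The row of `(c, Z)` that party `i` uses at time `t` if it is online. -/
def onlineIndex (i : P) (t : Fin (T + 1)) : Fin (T + 1) :=
  ⟨E.onlineCount i t, lt_of_le_of_lt (E.onlineCount_le i t) t.isLt⟩

/-- The coefficient with which party `i` injects its value at time `t`. -/
def onlineCoeff (i : P) (t : Fin (T + 1)) : ℝ :=
  if i ∈ E.online t then E.coeff (E.onlineIndex i t) else 0

/-- The coefficients of the canceling noise terms that party `i` injects at time `t`: the next unused
row of `Z`, except that at the last time `T` an online party cancels all that it has injected. -/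
def onlineNoise (i : P) (t : Fin (T + 1)) (k : Fin T) : ℝ :=
  if i ∈ E.online t then
    if t = Fin.last T then
      -∑ s ∈ Finset.univ.filter (fun s => s < E.onlineIndex i t), E.noiseMat s k
    else E.noiseMat (E.onlineIndex i t) k
  else 0

/-- The total weight with which the value of party `i` is injected. -/
def totalWeight (i : P) : ℝ := ∑ t, E.onlineCoeff i t

/-- What party `i` injects at time `t`, where `u` is the vector of the private values plus the
independent noise, and `η` holds the canceling noise terms. -/
def injection (u : P → ℝ) (η : P → Fin T → ℝ) (t : Fin (T + 1)) (i : P) : ℝ :=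
  E.onlineCoeff i t * u i + ∑ k, E.onlineNoise i t k * η i k

/-- The messages of all parties at every time. (A party that is offline in an iteration injects
nothing and keeps its message, because of its row of `onlineWeight`.) -/
def message (u : P → ℝ) (η : P → Fin T → ℝ) : Fin (T + 1) → P → ℝ :=
  fun t => Fin.induction (motive := fun _ => P → ℝ) (E.injection u η 0)
    (fun t y i => ∑ j, E.onlineWeight t i j * y j + E.injection u η t.succ i) t

/-- The messages seen when the parties in `C` are corrupted: those that a party of `C` sends or
receives, and the final messages of all parties. A pair `(i, t)` stands for the message of party `i`
at time `t`, which is the one that `i` sends in the iteration from `t` to `t + 1`.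
For `C = ∅` these are just the final messages. -/
def collusionView (C : Finset P) : Set (P × Fin (T + 1)) :=
  {p | p.2 = Fin.last T ∨
    ∃ t : Fin T, p.2 = t.castSucc ∧ (p.1 ∈ C ∨ ∃ j ∈ C, E.onlineWeight t j p.1 ≠ 0)}

/-- The adversary, who observes the pairs in `V`, has seen the message that `i` holds at time `t`:
it observes `i` at a time `s` such that `i` was offline, and hence did not renew its message, at all
the times between. -/
def Seen {P : Type*} [Fintype P] {T : ℕ} (E : Execution P T)
    (V : Set (P × Fin (T + 1))) (i : P) (t : Fin (T + 1)) : Prop :=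
  ∃ s, (i, s) ∈ V ∧ ∀ r, min s t < r → r ≤ max s t → i ∉ E.online r

/-- The edges of the graph of unseen exchanges among the honest parties, over all iterations: in some
iteration `i` sends to `j` a message that the adversary has not seen. -/
def HiddenEdge (C : Finset P) (V : Set (P × Fin (T + 1))) (i j : {i // i ∉ C}) : Prop :=
  ∃ t : Fin T, 0 < E.onlineWeight t j i ∧ ¬ E.Seen V i t.castSucc

/-- The directed graph of unseen exchanges among the honest parties is strongly connected. -/
def HiddenStronglyConnected (C : Finset P) (V : Set (P × Fin (T + 1))) : Prop :=
  ∀ i j : {i // i ∉ C}, Relation.ReflTransGen (E.HiddenEdge C V) i j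

/-- The values of the messages observed by the adversary, as a function of the honest parties' private
values plus independent noise `u` and canceling noise `η`; `uC` and `ηC` are those of the corrupted
parties, which the adversary knows. -/
def view (C : Finset P) (V : Set (P × Fin (T + 1)))
    (uC : {i // i ∈ C} → ℝ) (ηC : {i // i ∈ C} → Fin T → ℝ)
    (u : {i // i ∉ C} → ℝ) (η : {i // i ∉ C} → Fin T → ℝ) : V → ℝ :=
  fun p => E.message (glue C u uC) (glue C η ηC) p.1.2 p.1.1

/-- The law of the noise of the honest parties: all terms are independent centered Gaussians, the
independent ones with variance `vInd` and the canceling ones with variance `vΔ`. -/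
def noiseLaw (H : Type*) [Fintype H] (T : ℕ) (vInd vΔ : ℝ≥0) :
    Measure ((H → ℝ) × (H → Fin T → ℝ)) :=
  (Measure.pi fun _ => gaussianReal 0 vInd).prod
    (Measure.pi fun _ => Measure.pi fun _ => gaussianReal 0 vΔ)

/-- The execution is `(ε, δ)`-DP for the private values of the honest parties, against an adversary
that knows all public data, corrupts `C` and observes the messages in `V`. The guarantee holds for all
values and noise terms of the corrupted parties, which are known to the adversary.
With `C = ∅` this is Eavesdrop DP for the observations `V`; when `V` is the set of messages
seen through the corruption of `C`, it is Collusion DP. -/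
def ExecutionDP (C : Finset P) (V : Set (P × Fin (T + 1))) (vInd vΔ : ℝ≥0) (ε δ : ℝ) : Prop :=
  ∀ (uC : {i // i ∈ C} → ℝ) (ηC : {i // i ∈ C} → Fin T → ℝ),
    IsDP Neighboring (noiseLaw {i // i ∉ C} T vInd vΔ)
      (fun x ω => E.view C V uC ηC (x + ω.1) ω.2) ε δ

end Execution

end

/-!
The proof has a linear-algebraic and a probabilistic half.

*Hiding a change.* The view depends linearly on the inputs and the noise, so it has to be shown that
a change `δ` of the honest inputs with `∑ i, w i * δ i = 0` can be compensated by the canceling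
noise (`Execution.exists_noise_message_eq_zero`). Since `Z` without its last row is invertible, a
party can inject any prescribed amounts at the times when it is online, as long as their total is
`w i * δ i` (`Execution.exists_noise_eq`). So one looks for a change `y` of the messages that
vanishes on the observed pairs, is constant while a party is offline, and needs the total injections
`w i * δ i`. The possible totals form a subspace; a functional `g` that vanishes on it satisfies
`∑ i, g i * W t i j = g j` whenever the message of `j` at time `t` is unseen, where `W` is the
matrix of real exchange weights. As `W` is column-stochastic, this says that `g j` is an average of
the values of `g` at the receivers, and the maximum principle on the strongly connected graph of
unseen exchanges makes `g` constant on the honest parties, so that it also vanishes at every vector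
on the honest parties with sum zero. Hence all these vectors are possible totals
(`Execution.exists_hiddenChange`).

For datasets that differ by `d` at `i₀`, the independent noise is shifted by
`d * w i₀ / (∑ i, w i ^ 2)` times `w`, the shortest vector with the right weighted sum. By the
Cauchy-Schwarz inequality its squared length is at most `(n - 1) / (∑ i, w i - 1) ^ 2`
(`sq_div_sum_sq_le`).

*The Gaussian mechanism.* The log-likelihood ratio of a shifted product of Gaussians is Gaussian,
with variance `s2` equal to the sum of the squared shifts over the variances (`HasGaussianShift`).
If `s2 ≤ ε ^ 2 / c ^ 2`, then a tail bound shows that it exceeds `ε` with probability at most `δ`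
(`gaussianReal_privacyLoss_Ioi_le`), and elsewhere the shift costs at most a factor `exp ε`
(`HasGaussianShift.measure_shift_le`).
-/

/-! ### Tails of the real Gaussian distribution -/

lemma gaussianReal_Ioi_zero_le : gaussianReal 0 1 (Set.Ioi 0) ≤ ENNReal.ofReal (1 / 2) := by
  have hsymm : gaussianReal 0 1 (Set.Iio 0) = gaussianReal 0 1 (Set.Ioi 0) := by
    conv_lhs => rw [← neg_zero (G := ℝ), ← gaussianReal_map_neg]
    rw [Measure.map_apply (by fun_prop) measurableSet_Iio]
    congr 1
    ext x
    simp
  have hsum : gaussianReal 0 1 (Set.Ioi 0) + gaussianReal 0 1 (Set.Iio 0) ≤ 1 := by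
    have hdisj : Disjoint (Set.Ioi (0 : ℝ)) (Set.Iio 0) :=
      Set.disjoint_left.2 fun x hx hx' => lt_asymm (Set.mem_Ioi.1 hx) hx'
    rw [← measure_union hdisj measurableSet_Iio]
    exact prob_le_one
  rw [hsymm, ← two_mul] at hsum
  rw [ENNReal.ofReal_div_of_pos two_pos, ENNReal.ofReal_one, ENNReal.ofReal_ofNat,
    ENNReal.le_div_iff_mul_le (by simp) (by simp), mul_comm]
  exact hsum

lemma gaussianReal_Ioi_le_exp {t : ℝ} (ht : 0 ≤ t) :
    gaussianReal 0 1 (Set.Ioi t) ≤ ENNReal.ofReal (Real.exp (-t ^ 2 / 2) / 2) := by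
  have hshift : gaussianReal 0 1 (Set.Ioi t) = gaussianReal (-t) 1 (Set.Ioi 0) := by
    have h := gaussianReal_map_add_const (μ := 0) (v := 1) (-t)
    rw [zero_add] at h
    rw [← h, Measure.map_apply (by fun_prop) measurableSet_Ioi]
    congr 1
    ext x
    simp
  rw [hshift, gaussianReal_apply _ one_ne_zero]
  calc ∫⁻ x in Set.Ioi 0, gaussianPDF (-t) 1 x
      ≤ ∫⁻ x in Set.Ioi 0, ENNReal.ofReal (Real.exp (-t ^ 2 / 2)) * gaussianPDF 0 1 x := by
        refine setLIntegral_mono (by fun_prop) fun x hx => ?_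
        rw [gaussianPDF, gaussianPDF, ← ENNReal.ofReal_mul (Real.exp_nonneg _)]
        apply ENNReal.ofReal_le_ofReal
        rw [gaussianPDFReal_def, gaussianPDFReal_def, mul_left_comm, ← Real.exp_add]
        refine mul_le_mul_of_nonneg_left (Real.exp_le_exp.2 ?_) (by positivity)
        have : 0 ≤ x * t := mul_nonneg (le_of_lt hx) ht
        simp only [NNReal.coe_one]
        linarith [show -(x - -t) ^ 2 / (2 * 1) = -t ^ 2 / 2 + -(x - 0) ^ 2 / (2 * 1) - x * t by ring]
    _ = ENNReal.ofReal (Real.exp (-t ^ 2 / 2)) * gaussianReal 0 1 (Set.Ioi 0) := by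
        rw [lintegral_const_mul _ (by fun_prop), gaussianReal_apply _ one_ne_zero]
    _ ≤ ENNReal.ofReal (Real.exp (-t ^ 2 / 2)) * ENNReal.ofReal (1 / 2) := by
        gcongr
        exact gaussianReal_Ioi_zero_le
    _ = _ := by
        rw [← ENNReal.ofReal_mul (Real.exp_nonneg _)]
        ring_nf

lemma gaussianReal_Ioi_le_of_nonpos {t : ℝ} (ht : t ≤ 0) :
    gaussianReal 0 1 (Set.Ioi t) ≤ ENNReal.ofReal (1 / 2 - t / 2) := by
  have hIoc : gaussianReal 0 1 (Set.Ioc t 0) ≤ ENNReal.ofReal (-t / 2) := by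
    rw [gaussianReal_apply _ one_ne_zero]
    calc ∫⁻ x in Set.Ioc t 0, gaussianPDF 0 1 x
        ≤ ∫⁻ x in Set.Ioc t 0, ENNReal.ofReal (1 / 2) := by
          refine lintegral_mono fun x => ENNReal.ofReal_le_ofReal ?_
          -- The density is at most `1 / √(2π)`, and `√(2π) ≥ 2`.
          rw [gaussianPDFReal_def]
          have h2 : 2 ≤ √(2 * Real.pi * (1 : ℝ≥0)) := by
            apply Real.le_sqrt_of_sq_le
            simp only [NNReal.coe_one]
            linarith [Real.pi_gt_three]
          have h3 : Real.exp (-(x - 0) ^ 2 / (2 * (1 : ℝ≥0))) ≤ 1 := by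
            rw [Real.exp_le_one_iff]
            simp only [NNReal.coe_one]
            nlinarith [sq_nonneg (x - 0)]
          calc _ ≤ (2 : ℝ)⁻¹ * 1 :=
                mul_le_mul (inv_anti₀ two_pos h2) h3 (Real.exp_nonneg _) (by norm_num)
            _ = 1 / 2 := by norm_num
      _ = ENNReal.ofReal (-t / 2) := by
          rw [setLIntegral_const, Real.volume_Ioc, ← ENNReal.ofReal_mul (by norm_num)]
          ring_nf
  calc gaussianReal 0 1 (Set.Ioi t)
      ≤ gaussianReal 0 1 (Set.Ioc t 0) + gaussianReal 0 1 (Set.Ioi 0) := by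
        rw [← Set.Ioc_union_Ioi_eq_Ioi ht]
        exact measure_union_le _ _
    _ ≤ ENNReal.ofReal (-t / 2) + ENNReal.ofReal (1 / 2) := by
        gcongr
        exact gaussianReal_Ioi_zero_le
    _ = _ := by
        rw [← ENNReal.ofReal_add (by linarith) (by norm_num)]
        ring_nf

/-- The numerical core of the Gaussian mechanism. A privacy loss with standard deviation `s ≤ ε / c`
and mean `s ^ 2 / 2` exceeds `ε ≤ 1` only if its standardization exceeds `c - 1 / (2 * c)`. The
cases `1 / 2 ≤ c ^ 2` and `c ^ 2 < 1 / 2` need the exponential and the linear tail bound,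
respectively. -/
lemma gaussianReal_Ioi_le_of_log_lt {δ c : ℝ} (hδ : 0 < δ) (hδ1 : δ < 1) (hc0 : 0 < c)
    (hc : 2 * Real.log (1.25 / δ) < c ^ 2) :
    gaussianReal 0 1 (Set.Ioi (c - 1 / (2 * c))) ≤ ENNReal.ofReal δ := by
  have hδc : 1.25 * Real.exp (-c ^ 2 / 2) ≤ δ := by
    have h1 : Real.log (1.25 / δ) < c ^ 2 / 2 := by linarith
    have h2 := (Real.log_lt_iff_lt_exp (by positivity)).1 h1
    rw [div_lt_iff₀ hδ] at h2
    have h3 : Real.exp (c ^ 2 / 2) * Real.exp (-c ^ 2 / 2) = 1 := by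
      rw [← Real.exp_add]
      simp [neg_div]
    nlinarith [Real.exp_pos (-c ^ 2 / 2)]
  have hc2 : 0.4 < c ^ 2 := by
    have h1 := Real.one_sub_inv_le_log_of_pos (x := 1.25 / δ) (by positivity)
    rw [inv_div] at h1
    have : δ / 1.25 < 1 / 1.25 := by gcongr
    norm_num at this h1 ⊢
    linarith
  set t := c - 1 / (2 * c) with ht
  have htc : t * c = c ^ 2 - 1 / 2 := by
    rw [ht]
    field_simp
  rcases le_total 0 t with h0 | h0
  · refine (gaussianReal_Ioi_le_exp h0).trans (ENNReal.ofReal_le_ofReal (le_trans ?_ hδc))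
    have h1 : c ^ 2 - 1 ≤ t ^ 2 := by
      have : t ^ 2 = c ^ 2 - 1 + (1 / (2 * c)) ^ 2 := by
        rw [ht]
        field_simp
        ring
      nlinarith [sq_nonneg (1 / (2 * c))]
    have h2 : Real.exp (-t ^ 2 / 2) ≤ Real.exp (1 / 2) * Real.exp (-c ^ 2 / 2) := by
      rw [← Real.exp_add]
      gcongr
      linarith
    have h3 : Real.exp (1 / 2) ≤ 2.5 := by
      have h4 : Real.exp (1 / 2) * Real.exp (1 / 2) = Real.exp 1 := by
        rw [← Real.exp_add]
        norm_num
      nlinarith [Real.exp_one_lt_d9, Real.exp_pos (1 / 2 : ℝ)]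
    nlinarith [Real.exp_pos (-c ^ 2 / 2)]
  · refine (gaussianReal_Ioi_le_of_nonpos h0).trans (ENNReal.ofReal_le_ofReal (le_trans ?_ hδc))
    have h1 : c ^ 2 ≤ 1 / 2 := by nlinarith
    have h2 : 0.6 < c := by nlinarith
    have h3 : -t ≤ 0.2 := by nlinarith
    have h4 := Real.add_one_le_exp (-c ^ 2 / 2)
    norm_num at h2 h3 ⊢
    linarith

/-- A Gaussian privacy loss of variance `s2 ≤ ε ^ 2 / c ^ 2` and mean `s2 / 2` exceeds `ε` with
probability at most `δ`. -/
lemma gaussianReal_privacyLoss_Ioi_le {s2 : ℝ≥0} {ε δ c : ℝ} (hε : 0 < ε) (hε1 : ε < 1)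
    (hδ : 0 < δ) (hδ1 : δ < 1) (hc : 2 * Real.log (1.25 / δ) < c ^ 2)
    (hs : (s2 : ℝ) ≤ ε ^ 2 / c ^ 2) :
    gaussianReal (s2 / 2) s2 (Set.Ioi ε) ≤ ENNReal.ofReal δ := by
  have hc2 : 0 < c ^ 2 := by
    refine lt_trans ?_ hc
    have : 0 < Real.log (1.25 / δ) := by
      apply Real.log_pos
      rw [lt_div_iff₀ hδ]
      linarith
    linarith
  have hc0 : 0 < |c| := abs_pos.2 (by rintro rfl; norm_num at hc2)
  rw [← sq_abs c] at hc hs hc2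
  generalize |c| = c at hc hs hc2 hc0
  rcases eq_or_ne s2 0 with rfl | hs0
  · simp [hε.le]
  have hspos : 0 < (s2 : ℝ) := by positivity
  set s := √(s2 : ℝ) with hsdef
  have hs1 : 0 < s := Real.sqrt_pos.2 hspos
  have hss : s ^ 2 = s2 := Real.sq_sqrt hspos.le
  have hmap : gaussianReal (s2 / 2) s2 = (gaussianReal 0 1).map (fun x => s * x + s2 / 2) := by
    have h := Measure.map_map (μ := gaussianReal 0 1) (g := (· + (s2 / 2 : ℝ))) (f := (s * ·))
      (by fun_prop) (by fun_prop)
    rw [gaussianReal_map_const_mul, gaussianReal_map_add_const] at h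
    rw [show (fun x => s * x + s2 / 2) = ((· + (s2 / 2 : ℝ)) ∘ (s * ·)) from rfl, ← h]
    congr 1
    · simp
    · ext
      simp [hss]
  have hsc : s * c ≤ ε := by
    rw [← hss, ← div_pow] at hs
    have := (sq_le_sq₀ hs1.le (by positivity)).1 hs
    rwa [le_div_iff₀ hc0] at this
  rw [hmap, Measure.map_apply (by fun_prop) measurableSet_Ioi]
  refine le_trans (measure_mono fun x hx => ?_) (gaussianReal_Ioi_le_of_log_lt hδ hδ1 hc0 hc)
  simp only [Set.mem_preimage, Set.mem_Ioi] at hx ⊢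
  have h1 : s / 2 ≤ 1 / (2 * c) := by
    rw [div_le_div_iff₀ two_pos (by positivity)]
    nlinarith
  have h2 : s * (c - 1 / (2 * c)) < s * x := by
    nlinarith
  exact lt_of_mul_lt_mul_left h2 hs1.le

/-! ### Shifts of Gaussian product measures -/

/-- Under `μ`, the shift by `θ` has a log-likelihood ratio `L` that is Gaussian with variance `s2`
and mean `-s2 / 2`, and that the shift itself translates by `s2`. A product of centered Gaussians
has this property, where `s2` is the sum of the squared shifts over the variances. -/
def HasGaussianShift {Ω : Type*} [MeasurableSpace Ω] [Add Ω] (μ : Measure Ω) (θ : Ω) (s2 : ℝ≥0) :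
    Prop :=
  ∃ L : Ω → ℝ, Measurable L ∧
    μ.map (· + θ) = μ.withDensity (fun ω => ENNReal.ofReal (Real.exp (L ω))) ∧
    μ.map L = gaussianReal (-(s2 / 2)) s2 ∧ ∀ ω, L (ω + θ) = L ω + s2

/-- The Gaussian mechanism: where the privacy loss is at most `ε`, the shift multiplies the measure
by at most `exp ε`, and it exceeds `ε` with probability at most `δ`. -/
lemma HasGaussianShift.measure_shift_le {Ω : Type*} [MeasurableSpace Ω] [Add Ω] [MeasurableAdd Ω]
    {μ : Measure Ω} {θ : Ω} {s2 : ℝ≥0} (h : HasGaussianShift μ θ s2) {ε δ c : ℝ} (hε : 0 < ε)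
    (hε1 : ε < 1) (hδ : 0 < δ) (hδ1 : δ < 1) (hc : 2 * Real.log (1.25 / δ) < c ^ 2)
    (hs : (s2 : ℝ) ≤ ε ^ 2 / c ^ 2) {A : Set Ω} (hA : MeasurableSet A) :
    μ {ω | ω + θ ∈ A} ≤ ENNReal.ofReal (Real.exp ε) * μ A + ENNReal.ofReal δ := by
  obtain ⟨L, hL, hdens, hlaw, hshift⟩ := h
  have hbig : MeasurableSet {ω | ε < L ω} := measurableSet_lt measurable_const hL
  have hadd : Measurable fun ω : Ω => ω + θ := measurable_add_const θ
  calc μ {ω | ω + θ ∈ A} = μ.map (· + θ) A := (Measure.map_apply hadd hA).symm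
    _ ≤ μ.map (· + θ) (A \ {ω | ε < L ω}) + μ.map (· + θ) {ω | ε < L ω} := by
        refine le_trans (measure_mono ?_) (measure_union_le _ _)
        rw [Set.sdiff_union_self]
        exact Set.subset_union_left
    _ ≤ ENNReal.ofReal (Real.exp ε) * μ A + ENNReal.ofReal δ := by
        refine add_le_add ?_ ?_
        · rw [hdens, withDensity_apply _ (hA.diff hbig)]
          calc ∫⁻ ω in A \ {ω | ε < L ω}, ENNReal.ofReal (Real.exp (L ω)) ∂μ
              ≤ ∫⁻ ω in A \ {ω | ε < L ω}, ENNReal.ofReal (Real.exp ε) ∂μ := by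
                refine setLIntegral_mono measurable_const fun ω hω => ?_
                have : L ω ≤ ε := not_lt.1 hω.2
                gcongr
            _ ≤ ENNReal.ofReal (Real.exp ε) * μ A := by
                rw [setLIntegral_const]
                gcongr
                exact Set.sdiff_subset
        · rw [Measure.map_apply hadd hbig]
          have hpre : (· + θ) ⁻¹' {ω | ε < L ω} = (fun ω => L ω + s2) ⁻¹' Set.Ioi ε := by
            ext ω
            simp [hshift]
          have hmap : μ.map (fun ω => L ω + s2) = gaussianReal (s2 / 2) s2 := by
            have h := Measure.map_map (μ := μ) (g := (· + (s2 : ℝ))) (f := L) (by fun_prop) hL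
            rw [hlaw, gaussianReal_map_add_const] at h
            rw [show (fun ω => L ω + s2) = (· + (s2 : ℝ)) ∘ L from rfl, ← h]
            congr 1
            ring
          rw [hpre, ← Measure.map_apply (by fun_prop) measurableSet_Ioi, hmap]
          exact gaussianReal_privacyLoss_Ioi_le hε hε1 hδ hδ1 hc hs

lemma hasGaussianShift_gaussianReal {v : ℝ≥0} (hv : v ≠ 0) (θ : ℝ) :
    HasGaussianShift (gaussianReal 0 v) θ ((θ ^ 2).toNNReal / v) := by
  have hv' : (v : ℝ) ≠ 0 := by exact_mod_cast hv
  have hs2 : (((θ ^ 2).toNNReal / v : ℝ≥0) : ℝ) = θ ^ 2 / v := by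
    simp [Real.coe_toNNReal _ (sq_nonneg θ)]
  refine ⟨fun x => θ / v * x - θ ^ 2 / (2 * v), by fun_prop, ?_, ?_, fun x => ?_⟩
  · rw [gaussianReal_map_add_const, gaussianReal_of_var_ne_zero _ hv,
      gaussianReal_of_var_ne_zero _ hv, ← withDensity_mul _ (by fun_prop) (by fun_prop)]
    congr 1
    ext x
    rw [Pi.mul_apply, gaussianPDF, gaussianPDF,
      ← ENNReal.ofReal_mul (gaussianPDFReal_nonneg _ _ _), gaussianPDFReal_def, gaussianPDFReal_def]
    beta_reduce
    rw [mul_assoc (_)⁻¹, ← Real.exp_add]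
    congr 3
    field_simp
    ring
  · have h := Measure.map_map (μ := gaussianReal 0 v) (g := (· - θ ^ 2 / (2 * v : ℝ)))
      (f := (θ / v * ·)) (by fun_prop) (by fun_prop)
    rw [gaussianReal_map_const_mul, gaussianReal_map_sub_const] at h
    rw [show (fun x => θ / v * x - θ ^ 2 / (2 * v)) =
      (· - θ ^ 2 / (2 * v : ℝ)) ∘ (θ / v * ·) from rfl, ← h]
    congr 1
    · rw [hs2]
      field_simp
      ring
    · ext
      rw [hs2]
      simp only [NNReal.coe_mul, NNReal.coe_mk]
      field_simp
  · rw [hs2]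
    field_simp
    ring

lemma HasGaussianShift.prod {Ω₁ Ω₂ : Type*} [MeasurableSpace Ω₁] [MeasurableSpace Ω₂]
    [Add Ω₁] [Add Ω₂] [MeasurableAdd Ω₁] [MeasurableAdd Ω₂] {μ₁ : Measure Ω₁} {μ₂ : Measure Ω₂}
    [IsProbabilityMeasure μ₁] [IsProbabilityMeasure μ₂] {θ₁ : Ω₁} {θ₂ : Ω₂} {s₁ s₂ : ℝ≥0}
    (h₁ : HasGaussianShift μ₁ θ₁ s₁) (h₂ : HasGaussianShift μ₂ θ₂ s₂) :
    HasGaussianShift (μ₁.prod μ₂) (θ₁, θ₂) (s₁ + s₂) := by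
  obtain ⟨L₁, hL₁, hdens₁, hlaw₁, hshift₁⟩ := h₁
  obtain ⟨L₂, hL₂, hdens₂, hlaw₂, hshift₂⟩ := h₂
  refine ⟨fun ω => L₁ ω.1 + L₂ ω.2, by fun_prop, ?_, ?_, fun ω => ?_⟩
  · have hadd₁ : Measurable fun ω : Ω₁ => ω + θ₁ := measurable_add_const θ₁
    have hadd₂ : Measurable fun ω : Ω₂ => ω + θ₂ := measurable_add_const θ₂
    have h := Measure.map_prod_map μ₁ μ₂ hadd₁ hadd₂
    have hprob₂ := Measure.isProbabilityMeasure_map (μ := μ₂) hadd₂.aemeasurable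
    rw [hdens₂] at hprob₂
    rw [hdens₁, hdens₂, prod_withDensity (by fun_prop) (by fun_prop)] at h
    rw [show (fun ω : Ω₁ × Ω₂ => ω + (θ₁, θ₂)) = Prod.map (· + θ₁) (· + θ₂) from rfl, ← h]
    congr 1
    ext ω
    rw [Real.exp_add, ENNReal.ofReal_mul (Real.exp_nonneg _)]
  · have hind : IndepFun (fun ω : Ω₁ × Ω₂ => L₁ ω.1) (fun ω => L₂ ω.2) (μ₁.prod μ₂) :=
      indepFun_prod hL₁ hL₂
    have hm₁ : (μ₁.prod μ₂).map (fun ω => L₁ ω.1) = gaussianReal (-(s₁ / 2)) s₁ := by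
      rw [show (fun ω : Ω₁ × Ω₂ => L₁ ω.1) = L₁ ∘ Prod.fst from rfl,
        ← Measure.map_map hL₁ measurable_fst, Measure.map_fst_prod]
      simpa using hlaw₁
    have hm₂ : (μ₁.prod μ₂).map (fun ω => L₂ ω.2) = gaussianReal (-(s₂ / 2)) s₂ := by
      rw [show (fun ω : Ω₁ × Ω₂ => L₂ ω.2) = L₂ ∘ Prod.snd from rfl,
        ← Measure.map_map hL₂ measurable_snd, Measure.map_snd_prod]
      simpa using hlaw₂
    have h := gaussianReal_add_gaussianReal_of_indepFun hind hm₁ hm₂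
    rw [show (fun ω : Ω₁ × Ω₂ => L₁ ω.1 + L₂ ω.2) =
      (fun ω => L₁ ω.1) + (fun ω => L₂ ω.2) from rfl, h]
    congr 1
    push_cast
    ring
  · simp only [Prod.fst_add, Prod.snd_add, hshift₁, hshift₂]
    push_cast
    ring

lemma HasGaussianShift.pi {ι : Type*} [Fintype ι] {Ω : ι → Type*} [∀ i, MeasurableSpace (Ω i)]
    [∀ i, Add (Ω i)] [∀ i, MeasurableAdd (Ω i)] {μ : ∀ i, Measure (Ω i)}
    [∀ i, IsProbabilityMeasure (μ i)] {θ : ∀ i, Ω i} {s : ι → ℝ≥0}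
    (h : ∀ i, HasGaussianShift (μ i) (θ i) (s i)) :
    HasGaussianShift (Measure.pi μ) θ (∑ i, s i) := by
  classical
  choose L hL hdens hlaw hshift using h
  refine ⟨fun ω => ∑ i, L i (ω i), by fun_prop, ?_, ?_, fun ω => ?_⟩
  · have hadd : ∀ i, Measurable fun ω : Ω i => ω + θ i := fun i => measurable_add_const (θ i)
    have hprob : ∀ i, IsProbabilityMeasure ((μ i).map (· + θ i)) := fun i =>
      Measure.isProbabilityMeasure_map (hadd i).aemeasurable
    rw [show (fun ω : ∀ i, Ω i => ω + θ) = fun ω i => ω i + θ i from rfl,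
      Measure.pi_map_pi fun i => (hadd i).aemeasurable]
    refine Measure.pi_eq fun A hA => ?_
    -- The density is a product, and so is the indicator of a box.
    have hbox : ∀ ω : ∀ i, Ω i, (Set.univ.pi A).indicator
        (fun ω => ENNReal.ofReal (Real.exp (∑ i, L i (ω i)))) ω =
        ∏ i, (A i).indicator (fun x => ENNReal.ofReal (Real.exp (L i x))) (ω i) := by
      intro ω
      by_cases hω : ω ∈ Set.univ.pi A
      · rw [Set.indicator_of_mem hω, Real.exp_sum,
          ENNReal.ofReal_prod_of_nonneg fun i _ => Real.exp_nonneg _]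
        exact Finset.prod_congr rfl fun i _ => (Set.indicator_of_mem (hω i trivial)
          (f := fun x => ENNReal.ofReal (Real.exp (L i x)))).symm
      · rw [Set.indicator_of_notMem hω]
        simp only [Set.mem_pi, Set.mem_univ, true_imp_iff, not_forall] at hω
        obtain ⟨i, hi⟩ := hω
        exact (Finset.prod_eq_zero (Finset.mem_univ i) (Set.indicator_of_notMem hi _)).symm
    rw [withDensity_apply _ (MeasurableSet.univ_pi hA),
      ← lintegral_indicator (MeasurableSet.univ_pi hA)]
    simp_rw [hbox]
    have hmeas : ∀ i, Measurable
        ((A i).indicator (fun x => ENNReal.ofReal (Real.exp (L i x)))) := fun i =>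
      Measurable.indicator (by fun_prop) (hA i)
    have hind := iIndepFun_pi (μ := μ) fun i => (hmeas i).aemeasurable
    rw [lintegral_prod_eq_prod_lintegral_of_indepFun Finset.univ _ hind
      fun i => (hmeas i).comp (measurable_pi_apply i)]
    refine Finset.prod_congr rfl fun i _ => ?_
    rw [hdens i, withDensity_apply _ (hA i), ← lintegral_indicator (hA i)]
    exact (measurePreserving_eval μ i).lintegral_comp (hmeas i)
  · have hind : iIndepFun (fun i (ω : ∀ i, Ω i) => L i (ω i)) (Measure.pi μ) :=
      iIndepFun_pi fun i => (hL i).aemeasurable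
    have hm : ∀ i, (Measure.pi μ).map (fun ω => L i (ω i)) = gaussianReal (-(s i / 2)) (s i) := by
      intro i
      rw [← hlaw i, ← (measurePreserving_eval μ i).map_eq,
        Measure.map_map (hL i) (measurable_pi_apply i)]
      rfl
    have hsum : ∀ S : Finset ι, (Measure.pi μ).map (∑ i ∈ S, fun ω => L i (ω i)) =
        gaussianReal (-((∑ i ∈ S, s i : ℝ≥0) / 2)) (∑ i ∈ S, s i) := by
      intro S
      induction S using Finset.induction_on with
      | empty =>
        rw [Finset.sum_empty, Finset.sum_empty, gaussianReal_zero_var]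
        have h := Measure.map_const (Measure.pi μ) (0 : ℝ)
        rw [measure_univ, one_smul] at h
        rw [NNReal.coe_zero, zero_div, neg_zero]
        exact h
      | insert i S hi ih =>
        rw [Finset.sum_insert hi, Finset.sum_insert hi]
        have hpair := (hind.indepFun_finsetSum_of_notMem
          (fun i => (hL i).comp (measurable_pi_apply i)) hi).symm
        rw [gaussianReal_add_gaussianReal_of_indepFun hpair (hm i) ih]
        congr 1
        push_cast
        ring
    have hfun : (fun ω : ∀ i, Ω i => ∑ i, L i (ω i)) = ∑ i, fun ω => L i (ω i) := by
      ext ω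
      simp
    rw [hfun, hsum]
  · simp only [Pi.add_apply, hshift, Finset.sum_add_distrib]
    push_cast
    ring

/-! ### The messages as a linear function of inputs and noise -/

lemma glue_add_smul {P α : Type*} [DecidableEq P] [AddCommGroup α] [Module ℝ α] (C : Finset P)
    (h h' : {i // i ∉ C} → α) (a : {i // i ∈ C} → α) (d : ℝ) :
    glue C (h + d • h') a = glue C h a + d • glue C h' 0 := by
  ext i
  by_cases hi : i ∈ C <;> simp [glue, hi]

namespace Execution

variable {P : Type*} [Fintype P] [DecidableEq P] {T : ℕ} (E : Execution P T)

lemma message_zero (u : P → ℝ) (η : P → Fin T → ℝ) (i : P) :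
    E.message u η 0 i = E.injection u η 0 i := rfl

lemma message_succ (u : P → ℝ) (η : P → Fin T → ℝ) (t : Fin T) (i : P) :
    E.message u η t.succ i =
      ∑ j, E.onlineWeight t i j * E.message u η t.castSucc j + E.injection u η t.succ i := rfl

/-- The messages are the only solution of their recursion. -/
lemma message_eq_of_recursion {u : P → ℝ} {η : P → Fin T → ℝ} {y : Fin (T + 1) → P → ℝ}
    (h0 : ∀ i, y 0 i = E.injection u η 0 i)
    (hsucc : ∀ t : Fin T, ∀ i,
      y t.succ i = ∑ j, E.onlineWeight t i j * y t.castSucc j + E.injection u η t.succ i)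
    (t : Fin (T + 1)) (i : P) : E.message u η t i = y t i := by
  induction t using Fin.induction generalizing i with
  | zero => rw [message_zero, h0]
  | succ t ih => simp only [message_succ, hsucc, ih]

lemma message_add_smul (u u' : P → ℝ) (η η' : P → Fin T → ℝ) (d : ℝ) (t : Fin (T + 1)) (i : P) :
    E.message (u + d • u') (η + d • η') t i = E.message u η t i + d * E.message u' η' t i := by
  have hinj : ∀ t i, E.injection (u + d • u') (η + d • η') t i =
      E.injection u η t i + d * E.injection u' η' t i := by
    intro t i
    simp only [injection, Pi.add_apply, Pi.smul_apply, smul_eq_mul, mul_add, Finset.sum_add_distrib,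
      Finset.mul_sum, mul_left_comm d]
    ring
  refine E.message_eq_of_recursion (y := fun t i => E.message u η t i + d * E.message u' η' t i)
    (fun i => ?_) (fun t i => ?_) t i
  · rw [hinj, message_zero, message_zero]
  · simp only [hinj, message_succ, mul_add, Finset.sum_add_distrib, Finset.mul_sum, mul_left_comm d]
    ring

lemma measurable_message {Ω : Type*} [MeasurableSpace Ω] {u : Ω → P → ℝ} {η : Ω → P → Fin T → ℝ}
    (hu : ∀ i, Measurable fun ω => u ω i) (hη : ∀ i k, Measurable fun ω => η ω i k)
    (t : Fin (T + 1)) (i : P) : Measurable fun ω => E.message (u ω) (η ω) t i := by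
  have hinj : ∀ t i, Measurable fun ω => E.injection (u ω) (η ω) t i := by
    intro t i
    unfold injection
    fun_prop
  induction t using Fin.induction generalizing i with
  | zero => exact hinj 0 i
  | succ t ih =>
    simp only [message_succ]
    fun_prop

lemma measurable_view (C : Finset P) (V : Set (P × Fin (T + 1)))
    (uC : {i // i ∈ C} → ℝ) (ηC : {i // i ∈ C} → Fin T → ℝ) (x : {i // i ∉ C} → ℝ) :
    Measurable fun ω : ({i // i ∉ C} → ℝ) × ({i // i ∉ C} → Fin T → ℝ) =>
      E.view C V uC ηC (x + ω.1) ω.2 := by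
  refine measurable_pi_lambda _ fun p => E.measurable_message (fun i => ?_) (fun i k => ?_) _ _
  · by_cases hi : i ∈ C
    · simp only [glue, hi, dite_true]
      fun_prop
    · simp only [glue, hi, dite_false, Pi.add_apply]
      fun_prop
  · by_cases hi : i ∈ C
    · simp only [glue, hi, dite_true]
      fun_prop
    · simp only [glue, hi, dite_false]
      fun_prop

/-! ### The injections that a single party can realize -/

lemma onlineCount_lt_onlineCount {i : P} {s t : Fin (T + 1)} (hst : s < t) (hs : i ∈ E.online s) :
    E.onlineCount i s < E.onlineCount i t := by
  refine Finset.card_lt_card ((Finset.ssubset_iff_of_subset fun k hk => ?_).2 ⟨s, ?_, ?_⟩)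
  · simp only [Finset.mem_filter] at hk ⊢
    exact ⟨hk.1, hk.2.1.trans hst, hk.2.2⟩
  · simp [hst, hs]
  · simp

lemma onlineIndex_injOn (i : P) : Set.InjOn (E.onlineIndex i) {t | i ∈ E.online t} := by
  intro s hs t ht hst
  have hval : E.onlineCount i s = E.onlineCount i t := congrArg Fin.val hst
  rcases lt_trichotomy s t with h | h | h
  · exact absurd hval (E.onlineCount_lt_onlineCount h hs).ne
  · exact h
  · exact absurd hval (E.onlineCount_lt_onlineCount h ht).ne'

/-- A party that is online at the end cancels all its noise. -/
lemma sum_onlineNoise_eq_zero {i : P} (hi : i ∈ E.online (Fin.last T)) (k : Fin T) :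
    ∑ t, E.onlineNoise i t k = 0 := by
  classical
  set S := Finset.univ.filter fun t => t < Fin.last T ∧ i ∈ E.online t with hS
  -- Before the last time, the party uses up the first rows of `Z`, each of them once.
  have himage : S.image (E.onlineIndex i) =
      Finset.univ.filter fun s => s < E.onlineIndex i (Fin.last T) := by
    refine Finset.eq_of_subset_of_card_le (fun s hs => ?_) ?_
    · obtain ⟨t, ht, rfl⟩ := Finset.mem_image.1 hs
      rw [hS, Finset.mem_filter] at ht
      exact Finset.mem_filter.2 ⟨Finset.mem_univ _, E.onlineCount_lt_onlineCount ht.2.1 ht.2.2⟩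
    · rw [Finset.card_image_of_injOn fun s hs t ht h => E.onlineIndex_injOn i
        (by simpa using (Finset.mem_filter.1 hs).2.2) (by simpa using (Finset.mem_filter.1 ht).2.2) h]
      have hIio : (Finset.univ.filter fun s => s < E.onlineIndex i (Fin.last T)) =
          Finset.Iio (E.onlineIndex i (Fin.last T)) := by
        ext
        simp
      rw [hIio, Fin.card_Iio]
      exact le_rfl
  have hearly : ∑ t ∈ S, E.onlineNoise i t k = ∑ s ∈ S.image (E.onlineIndex i), E.noiseMat s k := by
    rw [Finset.sum_image fun s hs t ht h => E.onlineIndex_injOn i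
      (by simpa using (Finset.mem_filter.1 hs).2.2) (by simpa using (Finset.mem_filter.1 ht).2.2) h]
    refine Finset.sum_congr rfl fun t ht => ?_
    have ht' := (Finset.mem_filter.1 ht).2
    rw [onlineNoise, if_pos ht'.2, if_neg ht'.1.ne]
  have hlate : ∑ t ∈ Finset.univ.filter (fun t => ¬(t < Fin.last T ∧ i ∈ E.online t)),
      E.onlineNoise i t k = E.onlineNoise i (Fin.last T) k := by
    refine Finset.sum_eq_single _ (fun t ht hne => ?_) fun h => ?_
    · have ht' := (Finset.mem_filter.1 ht).2
      rw [onlineNoise, if_neg fun hon => ht' ⟨Fin.lt_last_iff_ne_last.2 hne, hon⟩]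
    · simp at h
  rw [← Finset.sum_filter_add_sum_filter_not Finset.univ
    (fun t => t < Fin.last T ∧ i ∈ E.online t), hlate, ← hS, hearly, himage, onlineNoise, if_pos hi,
    if_pos rfl, add_neg_cancel]

/-- By a choice of its noise terms, a party can inject any prescribed amounts with the right total at
the times when it is online. The earlier amounts are met by inverting `Z` without its last row, and
the last one then follows from the total. -/
lemma exists_noise_eq (hZ : IsUnit (E.noiseMat.submatrix Fin.castSucc id)) (i : P) (u : ℝ)
    (v : Fin (T + 1) → ℝ) (hoff : ∀ t, i ∉ E.online t → v t = 0)
    (hsum : ∑ t, v t = E.totalWeight i * u) :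
    ∃ θ : Fin T → ℝ, ∀ t, E.onlineCoeff i t * u + ∑ k, E.onlineNoise i t k * θ k = v t := by
  classical
  set r : Fin T → ℝ := fun s => ∑ t ∈ Finset.univ.filter
    (fun t => i ∈ E.online t ∧ E.onlineIndex i t = s.castSucc), (v t - E.onlineCoeff i t * u) with hr
  obtain ⟨θ, hθ⟩ := Matrix.mulVec_surjective_iff_isUnit.2 hZ r
  have hearly : ∀ t, t ≠ Fin.last T →
      E.onlineCoeff i t * u + ∑ k, E.onlineNoise i t k * θ k = v t := by
    intro t ht
    by_cases hon : i ∈ E.online t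
    · have hlt : E.onlineCount i t < T :=
        (E.onlineCount_le i t).trans_lt (Fin.lt_last_iff_ne_last.2 ht)
      have hidx : E.onlineIndex i t = (⟨E.onlineCount i t, hlt⟩ : Fin T).castSucc := rfl
      have hrt : r ⟨E.onlineCount i t, hlt⟩ = v t - E.onlineCoeff i t * u := by
        rw [hr]
        refine Finset.sum_eq_single t (fun s hs hne => ?_) fun h => ?_
        · have hs' := (Finset.mem_filter.1 hs).2
          exact absurd (E.onlineIndex_injOn i hs'.1 hon (hs'.2.trans hidx.symm)) hne
        · simp [hon, hidx] at h
      have hrow := congrFun hθ ⟨E.onlineCount i t, hlt⟩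
      rw [hrt] at hrow
      have hnoise : ∀ k, E.onlineNoise i t k = E.noiseMat (E.onlineIndex i t) k := fun k => by
        rw [onlineNoise, if_pos hon, if_neg ht]
      simp only [hnoise, hidx]
      simp only [Matrix.mulVec, dotProduct, Matrix.submatrix_apply, id] at hrow
      rw [hrow]
      ring
    · simp [onlineCoeff, onlineNoise, hon, hoff t hon]
  refine ⟨θ, fun t => ?_⟩
  rcases ne_or_eq t (Fin.last T) with ht | rfl
  · exact hearly t ht
  by_cases hon : i ∈ E.online (Fin.last T)
  · -- The totals of both sides agree, hence so do the terms at the last time.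
    have htotal : ∑ t, (E.onlineCoeff i t * u + ∑ k, E.onlineNoise i t k * θ k) = ∑ t, v t := by
      rw [Finset.sum_add_distrib, Finset.sum_comm, hsum, totalWeight, Finset.sum_mul]
      simp only [← Finset.sum_mul, E.sum_onlineNoise_eq_zero hon, zero_mul, Finset.sum_const_zero,
        add_zero]
    rw [Fin.sum_univ_castSucc, Fin.sum_univ_castSucc v,
      Finset.sum_congr rfl fun t _ => hearly t.castSucc (Fin.castSucc_lt_last t).ne] at htotal
    exact add_left_cancel htotal
  · simp [onlineCoeff, onlineNoise, hon, hoff _ hon]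

/-! ### The weights of the real exchanges -/

lemma onlineWeight_nonneg (t : Fin T) (i j : P) : 0 ≤ E.onlineWeight t i j := by
  simp only [onlineWeight, Matrix.of_apply]
  split_ifs
  · exact add_nonneg (E.weight_nonneg _ _ _) (Finset.sum_nonneg fun k _ => E.weight_nonneg _ _ _)
  · exact E.weight_nonneg _ _ _
  all_goals norm_num

lemma onlineWeight_of_receiver_offline {t : Fin T} {i : P} (hi : i ∉ E.online t.succ) (j : P) :
    E.onlineWeight t i j = if j = i then 1 else 0 := by
  simp [onlineWeight, hi]

lemma onlineWeight_of_sender_offline {t : Fin T} {j : P} (hj : j ∉ E.online t.succ) (i : P) :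
    E.onlineWeight t i j = if i = j then 1 else 0 := by
  by_cases hij : i = j
  · subst hij
    simp [onlineWeight, hj]
  · simp [onlineWeight, hj, hij, Ne.symm hij]

/-- Dropouts keep the weights column-stochastic. -/
lemma sum_onlineWeight (t : Fin T) (j : P) : ∑ i, E.onlineWeight t i j = 1 := by
  by_cases hj : j ∈ E.online t.succ
  · have hterm : ∀ i, E.onlineWeight t i j =
        (if i ∈ E.online t.succ then E.weight t i j else 0) +
        (if i = j then ∑ k ∈ Finset.univ.filter (fun k => k ∉ E.online t.succ), E.weight t k j
          else 0) := by
      intro i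
      by_cases hij : i = j
      · subst hij
        simp [onlineWeight, hj]
      · simp [onlineWeight, hj, hij, Ne.symm hij]
    rw [Finset.sum_congr rfl fun i _ => hterm i, Finset.sum_add_distrib, ← Finset.sum_filter,
      Finset.sum_ite_eq' Finset.univ j, if_pos (Finset.mem_univ j),
      Finset.sum_filter_add_sum_filter_not, E.weight_col_sum]
  · simp [E.onlineWeight_of_sender_offline hj]

/-! ### Changes of the messages that the adversary cannot see -/

/-- The changes of the messages that vanish on the observed pairs and respect that a party does not
renew its message while it is offline. -/
def hiddenChanges (V : Set (P × Fin (T + 1))) : Submodule ℝ (Fin (T + 1) → P → ℝ) where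
  carrier := {y | (∀ t i, (i, t) ∈ V → y t i = 0) ∧
    ∀ (t : Fin T) (i : P), i ∉ E.online t.succ → y t.succ i = y t.castSucc i}
  add_mem' := fun hy hz =>
    ⟨fun t i h => by simp [hy.1 t i h, hz.1 t i h], fun t i h => by simp [hy.2 t i h, hz.2 t i h]⟩
  zero_mem' := by simp
  smul_mem' := fun d y hy =>
    ⟨fun t i h => by simp [hy.1 t i h], fun t i h => by simp [hy.2 t i h]⟩

/-- The total over all iterations of what each party has to inject in order that the messages change
by `y`, if the final messages do not change. -/
def netInjection : (Fin (T + 1) → P → ℝ) →ₗ[ℝ] (P → ℝ) where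
  toFun y i := ∑ t : Fin T, (y t.castSucc i - ∑ j, E.onlineWeight t i j * y t.castSucc j)
  map_add' y z := by
    ext i
    simp only [Pi.add_apply, mul_add, Finset.sum_add_distrib, Finset.sum_sub_distrib]
    ring
  map_smul' d y := by
    ext i
    simp only [Pi.smul_apply, smul_eq_mul, RingHom.id_apply, Finset.mul_sum, mul_sub,
      mul_left_comm d]

/-- Party `i` holds the same message at the times `s` and `t`, because it is offline at all times
after the earlier and up to the later of them. -/
def SameMessage {P : Type*} [Fintype P] {T : ℕ} (E : Execution P T) (i : P) (s t : Fin (T + 1)) :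
    Prop :=
  ∀ r, min s t < r → r ≤ max s t → i ∉ E.online r

lemma sameMessage_refl {P : Type*} [Fintype P] {T : ℕ} (E : Execution P T) (i : P)
    (t : Fin (T + 1)) : E.SameMessage i t t :=
  fun r h1 h2 => absurd (h1.trans_le h2) (by simp)

lemma sameMessage_succ_iff {P : Type*} [Fintype P] {T : ℕ} (E : Execution P T) {i : P} {s : Fin T}
    (hi : i ∉ E.online s.succ) (t : Fin (T + 1)) :
    E.SameMessage i s.succ t ↔ E.SameMessage i s.castSucc t := by
  refine ⟨fun h r h1 h2 => ?_, fun h r h1 h2 => ?_⟩ <;> by_cases hr : r = s.succ <;>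
    first
    | exact hr ▸ hi
    | refine h r ?_ ?_ <;>
      simp only [min_lt_iff, le_max_iff, Fin.lt_def, Fin.le_def, Fin.ext_iff, Fin.val_succ,
        Fin.val_castSucc] at * <;> omega

lemma not_mem_of_not_seen {P : Type*} [Fintype P] {T : ℕ} (E : Execution P T)
    {V : Set (P × Fin (T + 1))} {j : P} {t : Fin (T + 1)} (hj : ¬ E.Seen V j t) : (j, t) ∉ V :=
  fun h => hj ⟨t, h, E.sameMessage_refl j t⟩

open Classical in
/-- The change that adds one to the message that `j` holds at time `t`, as long as it is held. -/
noncomputable def messageIndicator (j : P) (t : Fin (T + 1)) : Fin (T + 1) → P → ℝ :=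
  fun s i => if i = j then if E.SameMessage j s t then 1 else 0 else 0

lemma messageIndicator_mem_hiddenChanges {V : Set (P × Fin (T + 1))} {j : P} {t : Fin (T + 1)}
    (hj : ¬ E.Seen V j t) : E.messageIndicator j t ∈ E.hiddenChanges V := by
  refine ⟨fun s i hs => ?_, fun s i hi => ?_⟩
  · rw [messageIndicator]
    split_ifs with h1 h2
    · subst h1
      exact absurd ⟨s, hs, h2⟩ hj
    all_goals rfl
  · rw [messageIndicator, messageIndicator]
    split_ifs with h1 h2 h3 h3
    · rfl
    · subst h1
      exact absurd ((E.sameMessage_succ_iff hi t).1 h2) h3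
    · subst h1
      exact absurd ((E.sameMessage_succ_iff hi t).2 h3) h2
    all_goals rfl

/-- Only the iteration in which `j` replaces its message contributes to the net injection. -/
lemma netInjection_messageIndicator {j : P} {t : Fin T} (hon : j ∈ E.online t.succ) (i : P) :
    E.netInjection (E.messageIndicator j t.castSucc) i =
      (if i = j then 1 else 0) - E.onlineWeight t i j := by
  classical
  change ∑ s : Fin T, _ = _
  have hsum : ∀ s : Fin T,
      ∑ k, E.onlineWeight s i k * E.messageIndicator j t.castSucc s.castSucc k =
      if E.SameMessage j s.castSucc t.castSucc then E.onlineWeight s i j else 0 := by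
    intro s
    simp [messageIndicator]
  rw [Finset.sum_eq_single t]
  · rw [hsum, messageIndicator, if_pos (E.sameMessage_refl _ _), if_pos (E.sameMessage_refl _ _)]
  · intro s _ hst
    rw [hsum, messageIndicator]
    by_cases hs : E.SameMessage j s.castSucc t.castSucc
    · have hoff : j ∉ E.online s.succ := by
        rcases lt_or_gt_of_ne hst with h | h
        · refine hs _ ?_ ?_ <;>
          simp only [min_lt_iff, le_max_iff, Fin.lt_def, Fin.le_def, Fin.val_succ,
            Fin.val_castSucc] at * <;> omega
        · refine absurd hon (hs _ ?_ ?_) <;>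
          simp only [min_lt_iff, le_max_iff, Fin.lt_def, Fin.le_def, Fin.val_succ,
            Fin.val_castSucc] at * <;> omega
      rw [if_pos hs, if_pos hs, E.onlineWeight_of_sender_offline hoff, sub_self]
    · simp [hs]
  · simp

/-- A functional that vanishes on the net injections of all hidden changes is harmonic at the
senders of unseen messages. -/
lemma sum_mul_onlineWeight_eq {V : Set (P × Fin (T + 1))} {g : P → ℝ}
    (hg : ∀ y ∈ E.hiddenChanges V, ∑ i, g i * E.netInjection y i = 0) {j : P} {t : Fin T}
    (hj : ¬ E.Seen V j t.castSucc) : ∑ i, g i * E.onlineWeight t i j = g j := by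
  by_cases hon : j ∈ E.online t.succ
  · have h := hg _ (E.messageIndicator_mem_hiddenChanges hj)
    simp only [E.netInjection_messageIndicator hon, mul_sub, Finset.sum_sub_distrib, mul_ite,
      mul_one, mul_zero, Finset.sum_ite_eq', Finset.mem_univ, if_true] at h
    linarith
  · simp [E.onlineWeight_of_sender_offline hon]

lemma onlineWeight_eq_zero_of_not_seen {C : Finset P} {V : Set (P × Fin (T + 1))}
    (hV : E.collusionView C ⊆ V) {i j : P} (hi : i ∈ C) {t : Fin T}
    (hj : (j, t.castSucc) ∉ V) : E.onlineWeight t i j = 0 := by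
  by_contra h
  exact hj (hV (Or.inr ⟨t, rfl, Or.inr ⟨i, hi, h⟩⟩))

/-- A maximum principle: a function that is harmonic at the senders of unseen messages takes its
maximum at all parties that can be reached from a maximizer by unseen exchanges, so it is constant
if these connect all honest parties. -/
lemma eq_of_forall_sum_mul_onlineWeight_eq {C : Finset P} {V : Set (P × Fin (T + 1))}
    (hV : E.collusionView C ⊆ V) (hconn : E.HiddenStronglyConnected C V) {g : P → ℝ}
    (hg : ∀ (j : P) (t : Fin T), ¬ E.Seen V j t.castSucc →
      ∑ i, g i * E.onlineWeight t i j = g j) (i j : {i // i ∉ C}) : g i = g j := by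
  have : Nonempty {i // i ∉ C} := ⟨i⟩
  obtain ⟨m, hm⟩ := Finite.exists_max fun i : {i // i ∉ C} => g i
  have hstep : ∀ a b, E.HiddenEdge C V a b → g a = g m → g b = g m := by
    rintro a b ⟨t, hpos, hseen⟩ ha
    have hzero : ∑ i, (g m - g i) * E.onlineWeight t i a = 0 := by
      simp only [sub_mul, Finset.sum_sub_distrib, ← Finset.mul_sum, E.sum_onlineWeight,
        hg a t hseen, ha, mul_one, sub_self]
    have hnonneg : ∀ i ∈ Finset.univ, 0 ≤ (g m - g i) * E.onlineWeight t i a := by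
      intro i _
      by_cases hi : i ∈ C
      · rw [E.onlineWeight_eq_zero_of_not_seen hV hi (E.not_mem_of_not_seen hseen), mul_zero]
      · exact mul_nonneg (sub_nonneg.2 (hm ⟨i, hi⟩)) (E.onlineWeight_nonneg t i a)
    have hb := (Finset.sum_eq_zero_iff_of_nonneg hnonneg).1 hzero b (Finset.mem_univ _)
    rcases mul_eq_zero.1 hb with h | h
    · linarith
    · exact absurd h hpos.ne'
  have hall : ∀ b : {i // i ∉ C}, g b = g m := by
    intro b
    induction hconn m b with
    | refl => rfl
    | tail _ hbc ih => exact hstep _ _ hbc ih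
  rw [hall i, hall j]

/-- Every way of moving weight among the honest parties is the net injection of a hidden change. -/
lemma exists_hiddenChange {C : Finset P} {V : Set (P × Fin (T + 1))}
    (hV : E.collusionView C ⊆ V) (hconn : E.HiddenStronglyConnected C V) {a : P → ℝ}
    (haC : ∀ i ∈ C, a i = 0) (ha : ∑ i, a i = 0) :
    ∃ y ∈ E.hiddenChanges V, E.netInjection y = a := by
  suffices h : a ∈ (E.hiddenChanges V).map E.netInjection by simpa using h
  by_contra hna
  obtain ⟨f, hfa, hf⟩ := Submodule.exists_le_ker_of_notMem hna
  have hfsum : ∀ b : P → ℝ, f b = ∑ i, f (Pi.single i 1) * b i := by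
    intro b
    conv_lhs => rw [pi_eq_sum_univ' b]
    simp only [map_sum, map_smul, smul_eq_mul, mul_comm]
  refine hfa ?_
  have hconst := E.eq_of_forall_sum_mul_onlineWeight_eq hV hconn (g := fun i => f (Pi.single i 1))
    fun j t hj => E.sum_mul_onlineWeight_eq (fun y hy => by
      rw [← hfsum]
      exact hf (Submodule.mem_map_of_mem hy)) hj
  by_cases hH : ∃ m, m ∉ C
  · obtain ⟨m, hm⟩ := hH
    rw [hfsum]
    calc ∑ i, f (Pi.single i 1) * a i = ∑ i, f (Pi.single m 1) * a i := by
          refine Finset.sum_congr rfl fun i _ => ?_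
          by_cases hi : i ∈ C
          · rw [haC i hi, mul_zero, mul_zero]
          · rw [hconst ⟨i, hi⟩ ⟨m, hm⟩]
      _ = 0 := by rw [← Finset.mul_sum, ha, mul_zero]
  · push Not at hH
    rw [show a = 0 from funext fun i => haC i (hH i), map_zero]

/-- A change of the honest inputs that preserves their weighted sum can be hidden by a change of the
noise. -/
lemma exists_noise_message_eq_zero (hZ : IsUnit (E.noiseMat.submatrix Fin.castSucc id))
    {C : Finset P} {V : Set (P × Fin (T + 1))} (hV : E.collusionView C ⊆ V)
    (hconn : E.HiddenStronglyConnected C V) (u : {i // i ∉ C} → ℝ)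
    (hu : ∑ i : {i // i ∉ C}, E.totalWeight i * u i = 0) :
    ∃ θ : {i // i ∉ C} → Fin T → ℝ,
      ∀ p ∈ V, E.message (glue C u 0) (glue C θ 0) p.2 p.1 = 0 := by
  have hlast : ∀ i, (i, Fin.last T) ∈ V := fun i => hV (Or.inl rfl)
  have hCV : ∀ i ∈ C, ∀ t, (i, t) ∈ V := by
    intro i hi t
    induction t using Fin.lastCases with
    | last => exact hlast i
    | cast t => exact hV (Or.inr ⟨t, rfl, Or.inl hi⟩)
  obtain ⟨y, hy, hnet⟩ := E.exists_hiddenChange hV hconn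
    (a := fun i => E.totalWeight i * glue C u 0 i) (fun i hi => by simp [glue, hi]) (by
      rw [← Fintype.sum_subtype_add_sum_subtype (fun i => i ∈ C)]
      have h1 : ∀ i : {i // i ∈ C}, E.totalWeight i * glue C u 0 i = 0 := fun i => by simp [glue]
      have h2 : ∀ i : {i // i ∉ C}, E.totalWeight i * glue C u 0 i = E.totalWeight i * u i :=
        fun i => by simp [glue, i.2]
      simp only [h1, h2, Finset.sum_const_zero, zero_add, hu])
  -- what has to be injected for the messages to be `y`
  set v : P → Fin (T + 1) → ℝ := fun i => Fin.cons (y 0 i)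
    fun t => y t.succ i - ∑ j, E.onlineWeight t i j * y t.castSucc j with hv
  have hv0 : ∀ i, v i 0 = y 0 i := fun i => rfl
  have hvs : ∀ i (t : Fin T),
      v i t.succ = y t.succ i - ∑ j, E.onlineWeight t i j * y t.castSucc j := fun i t => rfl
  have hsum : ∀ i, ∑ t, v i t = E.totalWeight i * glue C u 0 i := by
    intro i
    rw [← congrFun hnet i]
    change _ = ∑ t : Fin T, _
    have h1 := Fin.sum_univ_succ fun t => y t i
    rw [Fin.sum_univ_castSucc, hy.1 _ _ (hlast i), add_zero] at h1
    rw [Fin.sum_univ_succ, hv0, Finset.sum_sub_distrib, h1]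
    simp only [hvs, Finset.sum_sub_distrib]
    ring
  have hoff : ∀ i t, i ∉ E.online t → v i t = 0 := by
    intro i t hi
    induction t using Fin.cases with
    | zero => simp [E.online_zero] at hi
    | succ t =>
      simp [hvs, E.onlineWeight_of_receiver_offline hi, hy.2 t i hi]
  have hC : ∀ i ∈ C, ∀ t, v i t = 0 := by
    intro i hi t
    induction t using Fin.cases with
    | zero => exact hy.1 _ _ (hCV i hi 0)
    | succ t =>
      rw [hvs, hy.1 _ _ (hCV i hi _), Finset.sum_eq_zero, sub_zero]
      intro j _
      by_cases hj : (j, t.castSucc) ∈ V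
      · rw [hy.1 _ _ hj, mul_zero]
      · rw [E.onlineWeight_eq_zero_of_not_seen hV hi hj, zero_mul]
  choose θ hθ using fun i : {i // i ∉ C} => E.exists_noise_eq hZ i (u i) (v i) (hoff i)
    (by rw [hsum]; simp [glue, i.2])
  have hinj : ∀ t i, E.injection (glue C u 0) (glue C θ 0) t i = v i t := by
    intro t i
    by_cases hi : i ∈ C
    · simp [injection, glue, hi, hC i hi]
    · simpa [injection, glue, hi] using hθ ⟨i, hi⟩ t
  refine ⟨θ, fun p hp => ?_⟩
  rw [E.message_eq_of_recursion (y := y), hy.1 _ _ hp]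
  · intro i
    rw [hinj, hv0]
  · intro t i
    rw [hinj, hvs]
    ring

end Execution

/-! ### The cost of hiding a value in the independent noise -/

/-- Hiding a unit change of the value of `i₀` by the multiple of `w` of the same weighted sum is a
shift of squared length at most `(n - 1) / (∑ i, w i - 1) ^ 2`. -/
lemma sq_div_sum_sq_le {H : Type*} [Fintype H] {w : H → ℝ} (hH : 2 ≤ Fintype.card H)
    (h0 : ∀ i, 0 ≤ w i) (h1 : ∀ i, w i ≤ 1) (hw : ∑ i, w i ≠ 1) (i₀ : H) :
    w i₀ ^ 2 / ∑ i, w i ^ 2 ≤ ((Fintype.card H : ℝ) - 1) / (∑ i, w i - 1) ^ 2 := by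
  classical
  have hn : (2 : ℝ) ≤ Fintype.card H := by exact_mod_cast hH
  have hpos : 0 < (∑ i, w i - 1) ^ 2 := by
    have : ∑ i, w i - 1 ≠ 0 := sub_ne_zero.2 hw
    positivity
  have hsq : ∑ i, w i ^ 2 = w i₀ ^ 2 + ∑ i ∈ Finset.univ.erase i₀, w i ^ 2 :=
    (Finset.add_sum_erase _ _ (Finset.mem_univ i₀)).symm
  have hsum : ∑ i, w i = w i₀ + ∑ i ∈ Finset.univ.erase i₀, w i :=
    (Finset.add_sum_erase _ _ (Finset.mem_univ i₀)).symm
  have hrest : 0 ≤ ∑ i ∈ Finset.univ.erase i₀, w i ^ 2 := Finset.sum_nonneg fun i _ => sq_nonneg _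
  have hrest' : 0 ≤ ∑ i ∈ Finset.univ.erase i₀, w i := Finset.sum_nonneg fun i _ => h0 i
  have hcs := sq_sum_le_card_mul_sum_sq (s := Finset.univ.erase i₀) (f := w)
  rw [Finset.card_erase_of_mem (Finset.mem_univ i₀), Finset.card_univ,
    Nat.cast_sub (by omega), Nat.cast_one] at hcs
  refine div_le_of_le_mul₀ (by positivity) (div_nonneg (by linarith) hpos.le) ?_
  rw [div_mul_eq_mul_div, le_div_iff₀ hpos, hsq, hsum]
  set r := ∑ i ∈ Finset.univ.erase i₀, w i
  set q := ∑ i ∈ Finset.univ.erase i₀, w i ^ 2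
  have hi0 := h0 i₀
  have hi1 := h1 i₀
  rcases le_total 1 (w i₀ + r) with h | h
  · -- The total `s` of the weights satisfies `w i₀ * (s - 1) ≤ s - w i₀`.
    have h2 : w i₀ * (w i₀ + r - 1) ≤ r := by nlinarith
    have h3 : (w i₀ * (w i₀ + r - 1)) ^ 2 ≤ r ^ 2 := by
      gcongr
    nlinarith [sq_nonneg (w i₀)]
  · have h2 : (w i₀ + r - 1) ^ 2 ≤ 1 := by nlinarith
    nlinarith [sq_nonneg (w i₀)]

namespace Execution

variable {P : Type*} [Fintype P] [DecidableEq P] {T : ℕ} (E : Execution P T)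

/-! ### Differential privacy from hidden shifts -/

instance (H : Type*) [Fintype H] (T : ℕ) (vInd vΔ : ℝ≥0) :
    IsProbabilityMeasure (noiseLaw H T vInd vΔ) := by
  unfold noiseLaw
  infer_instance

lemma hasGaussianShift_noiseLaw {H : Type*} [Fintype H] {vInd vΔ : ℝ≥0} (hInd : vInd ≠ 0)
    (hΔ : vΔ ≠ 0) (θInd : H → ℝ) (θΔ : H → Fin T → ℝ) :
    HasGaussianShift (noiseLaw H T vInd vΔ) (θInd, θΔ)
      (∑ i, (θInd i ^ 2).toNNReal / vInd + ∑ i, ∑ k, (θΔ i k ^ 2).toNNReal / vΔ) :=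
  (HasGaussianShift.pi fun i => hasGaussianShift_gaussianReal hInd (θInd i)).prod
    (HasGaussianShift.pi fun i => HasGaussianShift.pi fun k =>
      hasGaussianShift_gaussianReal hΔ (θΔ i k))

/-- Shifts of the noise that turn `xB` into `xA` in the view of the adversary give differential
privacy if they are short in comparison with the standard deviations. -/
lemma executionDP_of_shift {C : Finset P} {V : Set (P × Fin (T + 1))}
    {θInd : ({i // i ∉ C} → ℝ) → ({i // i ∉ C} → ℝ) → {i // i ∉ C} → ℝ}
    {θΔ : ({i // i ∉ C} → ℝ) → ({i // i ∉ C} → ℝ) → {i // i ∉ C} → Fin T → ℝ}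
    (hview : ∀ xA xB, Neighboring xA xB → ∀ uC ηC ηInd η,
      E.view C V uC ηC (xA + ηInd) η =
        E.view C V uC ηC (xB + ηInd + θInd xA xB) (η + θΔ xA xB))
    {ε δ c : ℝ} (hε : 0 < ε) (hε1 : ε < 1) (hδ : 0 < δ) (hδ1 : δ < 1)
    (hc : 2 * Real.log (1.25 / δ) < c ^ 2) {vInd vΔ : ℝ≥0} (hInd : vInd ≠ 0) (hΔ : vΔ ≠ 0)
    (hbound : ∀ xA xB, Neighboring xA xB →
      (∑ i, θInd xA xB i ^ 2) / vInd + (∑ i, ∑ k, θΔ xA xB i k ^ 2) / vΔ ≤ ε ^ 2 / c ^ 2) :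
    E.ExecutionDP C V vInd vΔ ε δ := by
  intro uC ηC xA xB hx S hS
  have hshift := hasGaussianShift_noiseLaw hInd hΔ (θInd xA xB) (θΔ xA xB)
  have h := hshift.measure_shift_le hε hε1 hδ hδ1 hc (by
    refine le_of_eq_of_le ?_ (hbound xA xB hx)
    push_cast
    simp only [Real.coe_toNNReal _ (sq_nonneg _), Finset.sum_div]) (E.measurable_view C V uC ηC xB hS)
  convert! h using 3
  ext ω
  simp only [Set.mem_preimage, Prod.fst_add, Prod.snd_add]
  rw [hview xA xB hx, add_assoc]

end Execution

theorem mainTheorem6 {P : Type*} [Fintype P] [DecidableEq P] {T : ℕ}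
    (E : Execution P T) (hValid : E.Valid)
    (C : Finset P) (V : Set (P × Fin (T + 1))) (hV : E.collusionView C ⊆ V)
    (nH : ℕ) (hnH : nH = Fintype.card {i // i ∉ C}) (hnH2 : 2 ≤ nH)
    (hweight : ∀ i, i ∉ C → 0 ≤ E.totalWeight i ∧ E.totalWeight i ≤ 1)
    (w : ℝ) (hw : w = ∑ i : {i // i ∉ C}, E.totalWeight i) (hw1 : w ≠ 1)
    (hconn : E.HiddenStronglyConnected C V) :
    ∃ (θInd : ({i // i ∉ C} → ℝ) → ({i // i ∉ C} → ℝ) → {i // i ∉ C} → ℝ)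
      (θΔ : ({i // i ∉ C} → ℝ) → ({i // i ∉ C} → ℝ) → {i // i ∉ C} → Fin T → ℝ),
      (∀ xA xB, Neighboring xA xB → ∀ uC ηC ηInd η,
        E.view C V uC ηC (xA + ηInd) η =
          E.view C V uC ηC (xB + ηInd + θInd xA xB) (η + θΔ xA xB)) ∧
      (∃ K : ℝ, ∀ xA xB, Neighboring xA xB → ∑ i, ∑ k, (θΔ xA xB i k) ^ 2 ≤ K) ∧
      ∀ ε δ c : ℝ, 0 < ε → ε < 1 → 0 < δ → δ < 1 → 2 * Real.log (1.25 / δ) < c ^ 2 →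
      ∀ vInd vΔ : NNReal, 0 < vΔ →
        ((nH : ℝ) - 1) * c ^ 2 / ((w - 1) ^ 2 * ε ^ 2) < vInd →
        (∀ xA xB, Neighboring xA xB →
          (∑ i, ∑ k, (θΔ xA xB i k) ^ 2) /
            (ε ^ 2 / c ^ 2 - ((nH : ℝ) - 1) / ((w - 1) ^ 2 * vInd)) ≤ vΔ) →
        E.ExecutionDP C V vInd vΔ ε δ := by
  subst hnH hw
  have hW0 : ∀ i : {i // i ∉ C}, 0 ≤ E.totalWeight i := fun i => (hweight i i.2).1
  have hW1 : ∀ i : {i // i ∉ C}, E.totalWeight i ≤ 1 := fun i => (hweight i i.2).2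
  set W : {i // i ∉ C} → ℝ := fun i => E.totalWeight i
  -- The shortest shift of the independent noise with the weighted sum of a unit change at `i`. If
  -- all weights vanish, then the quotient is `0`, which is the right value.
  set g : {i // i ∉ C} → {i // i ∉ C} → ℝ := fun i => (W i / ∑ j, W j ^ 2) • W with hg
  have hgsum : ∀ i, ∑ j, W j * (g i - Pi.single i 1 : {i // i ∉ C} → ℝ) j = 0 := by
    intro i
    have h1 : ∑ j, W j * g i j = W i / (∑ j, W j ^ 2) * ∑ j, W j ^ 2 := by
      rw [Finset.mul_sum]
      refine Finset.sum_congr rfl fun j _ => ?_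
      simp only [hg, Pi.smul_apply, smul_eq_mul]
      ring
    have h2 : W i / (∑ j, W j ^ 2) * ∑ j, W j ^ 2 = W i := by
      rcases eq_or_ne (∑ j, W j ^ 2) 0 with h | h
      · have := (Finset.sum_eq_zero_iff_of_nonneg fun j _ => sq_nonneg (W j)).1 h i
          (Finset.mem_univ i)
        rw [pow_eq_zero_iff two_ne_zero] at this
        simp [this]
      · exact div_mul_cancel₀ _ h
    simp only [Pi.sub_apply, mul_sub, Finset.sum_sub_distrib, h1, h2]
    simp [Pi.single_apply]
  have hgsq : ∀ i, ∑ j, g i j ^ 2 ≤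
      ((Fintype.card {i // i ∉ C} : ℝ) - 1) / (∑ i, W i - 1) ^ 2 := by
    intro i
    refine le_of_eq_of_le ?_ (sq_div_sum_sq_le hnH2 hW0 hW1 hw1 i)
    simp only [hg, Pi.smul_apply, smul_eq_mul, mul_pow, ← Finset.mul_sum]
    generalize ∑ j, W j ^ 2 = q
    rcases eq_or_ne q 0 with h | h
    · simp [h]
    · field_simp
      rfl
  choose γ hγ using fun i => E.exists_noise_message_eq_zero hValid.2.2 hV hconn _ (hgsum i)
  -- Between neighboring datasets only one summand of the following shifts is nonzero.
  have hone : ∀ xA xB : {i // i ∉ C} → ℝ, Neighboring xA xB →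
      ∃ (i : {i // i ∉ C}) (d : ℝ), d ^ 2 ≤ 1 ∧
      xA - xB = d • Pi.single i 1 ∧ (∑ j, (xA j - xB j) • g j = d • g i) ∧
      ∑ j, (xA j - xB j) • γ j = d • γ i := by
    rintro xA xB ⟨hA, hB, i, hi⟩
    have h0 : ∀ j, j ≠ i → xA j - xB j = 0 := fun j hj => sub_eq_zero.2 (hi j hj)
    refine ⟨i, xA i - xB i, ?_, ?_, ?_, ?_⟩
    · rw [sq_le_one_iff_abs_le_one, abs_le]
      constructor <;> linarith [(hA i).1, (hA i).2, (hB i).1, (hB i).2]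
    · ext j
      by_cases hj : j = i
      · subst hj
        simp
      · simp [hj, hi j hj]
    · exact Finset.sum_eq_single i (fun j _ hj => by rw [h0 j hj, zero_smul]) (by simp)
    · exact Finset.sum_eq_single i (fun j _ hj => by rw [h0 j hj, zero_smul]) (by simp)
  have hview : ∀ xA xB, Neighboring xA xB → ∀ uC ηC ηInd η, E.view C V uC ηC (xA + ηInd) η =
      E.view C V uC ηC (xB + ηInd + ∑ j, (xA j - xB j) • g j) (η + ∑ j, (xA j - xB j) • γ j) := by
    intro xA xB hx uC ηC ηInd η
    obtain ⟨i, d, -, hd, hgi, hγi⟩ := hone xA xB hx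
    ext p
    have hu : xB + ηInd + d • g i = xA + ηInd + d • (g i - Pi.single i 1) := by
      rw [smul_sub, ← hd]
      abel
    rw [hgi, hγi, hu, Execution.view, Execution.view, glue_add_smul, glue_add_smul,
      E.message_add_smul, hγ i p.1 p.2, mul_zero, add_zero]
  refine ⟨fun xA xB => ∑ j, (xA j - xB j) • g j, fun xA xB => ∑ j, (xA j - xB j) • γ j,
    hview, ⟨∑ j, ∑ i, ∑ k, γ j i k ^ 2, fun xA xB hx => ?_⟩, ?_⟩
  · obtain ⟨i, d, hd1, -, -, hγi⟩ := hone xA xB hx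
    have hnonneg : ∀ j, 0 ≤ ∑ i, ∑ k, γ j i k ^ 2 := fun j => by positivity
    calc _ = d ^ 2 * ∑ j, ∑ k, γ i j k ^ 2 := by
          simp only [hγi, Pi.smul_apply, smul_eq_mul, mul_pow, Finset.mul_sum]
      _ ≤ ∑ j, ∑ k, γ i j k ^ 2 := mul_le_of_le_one_left (hnonneg i) hd1
      _ ≤ _ := Finset.single_le_sum (f := fun j => ∑ i, ∑ k, γ j i k ^ 2)
          (fun j _ => hnonneg j) (Finset.mem_univ i)
  · intro ε δ c hε hε1 hδ hδ1 hc vInd vΔ hvΔ hvInd hΔ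
    have hc2 : 0 < c ^ 2 := by
      refine lt_trans (mul_pos two_pos (Real.log_pos ?_)) hc
      rw [lt_div_iff₀ hδ]
      linarith
    have hn : (0 : ℝ) ≤ (Fintype.card {i // i ∉ C} : ℝ) - 1 := by
      have : (2 : ℝ) ≤ Fintype.card {i // i ∉ C} := by exact_mod_cast hnH2
      linarith
    have hw2 : 0 < (∑ i, W i - 1) ^ 2 := by
      have : ∑ i, W i - 1 ≠ 0 := sub_ne_zero.2 hw1
      positivity
    have hvInd0 : (0 : ℝ) < vInd := lt_of_le_of_lt (by positivity) hvInd
    have hden : 0 < ε ^ 2 / c ^ 2 -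
        ((Fintype.card {i // i ∉ C} : ℝ) - 1) / ((∑ i, W i - 1) ^ 2 * vInd) := by
      rw [div_lt_iff₀ (by positivity)] at hvInd
      rw [sub_pos, div_lt_div_iff₀ (by positivity) hc2]
      linarith
    refine E.executionDP_of_shift hview hε hε1 hδ hδ1 hc (by exact_mod_cast hvInd0.ne')
      hvΔ.ne' fun xA xB hx => ?_
    obtain ⟨i, d, hd1, -, hgi, -⟩ := hone xA xB hx
    have h1 : (∑ j, (∑ k, (xA k - xB k) • g k) j ^ 2) / vInd ≤
        ((Fintype.card {i // i ∉ C} : ℝ) - 1) / ((∑ i, W i - 1) ^ 2 * vInd) := by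
      rw [← div_div]
      refine div_le_div_of_nonneg_right ?_ hvInd0.le
      simp only [hgi, Pi.smul_apply, smul_eq_mul, mul_pow, ← Finset.mul_sum]
      exact (mul_le_of_le_one_left (by positivity) hd1).trans (hgsq i)
    have h2 := hΔ xA xB hx
    have hvΔ' : (0 : ℝ) < vΔ := by exact_mod_cast hvΔ
    rw [div_le_iff₀ hden, mul_comm, ← div_le_iff₀ hvΔ'] at h2
    linarith
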